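/- Let $f(x)=a_0x^n+a_1x^{n-1}+\cdots+a_n$ be a polynomial of degree $n$ with real coefficients and $a_0>0$, put $a_k=0$ for integers $k<0$ and $k>n$, and let $M$ be an integer with $2\le M\le\lfloor n/2\rfloor+1$. Let $H_M=(a_{Mc-r})_{r,c=1}^\infty$ be the generalized Hurwitz matrix of $f$, and for $0\le i<j\le M-1$ let $$H_M^{(ij)}=\begin{pmatrix} a_j&a_{M+j}&a_{2M+j}&\cdots\\ a_i&a_{M+i}&a_{2M+i}&\cdots\\ 0&a_j&a_{M+j}&\cdots\\ 0&a_i&a_{M+i}&\cdots\\ \vdots&\vdots&\vdots&\ddots\end{pmatrix}$$ be its infinite submatrix formed by the rows that carry the coefficients with indices congruent to $i$ or $j$ modulo $M$; it is the ordinary Hurwitz matrix of the polynomial $P^{(ij)}(x)=\sum_{k\ge0}\bigl(a_{kM+i}x^{m-2k}+a_{kM+j}x^{m-2k-1}\bigr)$ of formal degree $m=m_{ij}$, where $m_{ij}=2\lfloor\frac{n-i}{M}\rfloor+1$ if $\lfloor\frac{n-i}{M}\rfloor=\lfloor\frac{n-j}{M}\rfloor$ and $m_{ij}=2\lfloor\frac{n-i}{M}\rfloor$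 otherwise. (Equivalently, $m_{ij}$ is the number of diagonal entries $a_j,a_{M+i},a_{M+j},a_{2M+i},\dots$ with index at most $n$; all leading principal minors of larger order vanish identically.) Suppose that for all $0\le i<j\le M-1$ the leading principal minors of $H_M^{(ij)}$ of orders $1,\dots,m_{ij}$ are positive. Then $f$ has no zeros in the closed cone $\{z\in\mathbb C:|\arg z|\le \pi/M\}$, the origin included. -/

import Mathlib

open Polynomial

namespace GenHurwitz

/-- The coefficient `a_k` of `f = a_0 x ^ n + a_1 x ^ (n - 1) + ... + a_n`, where `n` is the degree
of `f`, with the convention `a_k = 0` for integers `k < 0` and `k > n`. -/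
noncomputable def a (f : ℝ[X]) (k : ℤ) : ℝ :=
  if 0 ≤ k ∧ k ≤ (f.natDegree : ℤ) then f.coeff (f.natDegree - k.toNat) else 0

/-- The infinite generalized Hurwitz matrix `H_M(f) = (a_{M c - r})`, `r, c = 1, 2, ...`
(rows and columns are numbered from `0` here). -/
noncomputable def genHurwitz (f : ℝ[X]) (M : ℕ) : Matrix ℕ ℕ ℝ :=
  Matrix.of fun r c => a f ((M : ℤ) * ((c : ℤ) + 1) - ((r : ℤ) + 1))

/-- The rows of `H_M(f)` (numbered from `0`) that carry the coefficients `a_j, a_{M+j}, ...` and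
`a_i, a_{M+i}, ...`, in increasing order, for `i < j < M`: one row of each kind in every block of
`M` rows. -/
def pairRow (M i j : ℕ) (r : ℕ) : ℕ :=
  M * (r / 2) + (M - 1 - if r % 2 = 0 then j else i)

/-- The infinite submatrix `H_M^{(ij)}` of `H_M(f)` determined by the rows of the two residues
`i < j < M`. -/
noncomputable def hurwitzSub (f : ℝ[X]) (M i j : ℕ) : Matrix ℕ ℕ ℝ :=
  (genHurwitz f M).submatrix (pairRow M i j) id

/-- The rows of `H_M^{(ij)}` with an even number are the shifts of `(a_j, a_{M+j}, ...)`. -/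
theorem hurwitzSub_even (f : ℝ[X]) {M i j : ℕ} (hj : j < M) (q c : ℕ) :
    hurwitzSub f M i j (2 * q) c = a f ((M : ℤ) * ((c : ℤ) - (q : ℤ)) + (j : ℤ)) := by
  have h1 : 2 * q / 2 = q := by omega
  have h2 : 2 * q % 2 = 0 := by omega
  simp only [hurwitzSub, genHurwitz, pairRow, Matrix.submatrix_apply, Matrix.of_apply, id, h1, h2,
    if_true]
  congr 1
  have : ((M - 1 - j : ℕ) : ℤ) = (M : ℤ) - 1 - j := by omega
  push_cast [this]
  ring

/-- The rows of `H_M^{(ij)}` with an odd number are the shifts of `(a_i, a_{M+i}, ...)`. -/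
theorem hurwitzSub_odd (f : ℝ[X]) {M i j : ℕ} (hi : i < M) (q c : ℕ) :
    hurwitzSub f M i j (2 * q + 1) c = a f ((M : ℤ) * ((c : ℤ) - (q : ℤ)) + (i : ℤ)) := by
  have h1 : (2 * q + 1) / 2 = q := by omega
  have h2 : (2 * q + 1) % 2 = 1 := by omega
  simp only [hurwitzSub, genHurwitz, pairRow, Matrix.submatrix_apply, Matrix.of_apply, id, h1, h2,
    one_ne_zero, if_false]
  congr 1
  have : ((M - 1 - i : ℕ) : ℤ) = (M : ℤ) - 1 - i := by omega
  push_cast [this]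
  ring

/-- The leading principal minor of order `r` of an infinite matrix. -/
noncomputable def leadingMinor (A : Matrix ℕ ℕ ℝ) (r : ℕ) : ℝ :=
  (Matrix.of fun k l : Fin r => A k l).det

/-- The order `m` up to which the leading principal minors of `H_M^{(ij)}` are considered, for
`i < j < M` and `deg f = n`: the degree of the polynomial
`a_i x ^ m + a_j x ^ (m - 1) + a_{M+i} x ^ (m - 2) + a_{M+j} x ^ (m - 3) + ...` (all the terms with
coefficient index at most `n`), whose ordinary Hurwitz matrix is `H_M^{(ij)}`. Equivalently, the
number of diagonal entries `a_j, a_{M+i}, a_{M+j}, a_{2M+i}, ...` with index at most `n`.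
The minors of higher order are `0` for every `f` of degree `n`. -/
def pairDegree (n M i j : ℕ) : ℕ :=
  if (n - i) / M = (n - j) / M then 2 * ((n - i) / M) + 1 else 2 * ((n - i) / M)

end GenHurwitz

/-! Write `f(z) = z^n ∑ z^(-i) p_i(w)` with `w = z^(-M)` and `p_i(w) = ∑ a_{Mq+i} w^q`. Positive
minors for a pair `i < j` let the Routh algorithm run on `(p_i, p_j)`. Run backwards, it shows that
`p_i` and `p_j` have no common zero and that, for `Im w < 0`, `p_j conj(p_i)` lies in the cone
spanned by `1` and `conj w` (`aeval_mem_cone_of_leadingMinor_pos`).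

For `0 < θ = arg z < π/M` the `p_i(w)` therefore have arguments `φ_i` increasing with `i` and spread
over at most `Mθ` (`exists_monotone_args`). The summands have arguments `φ_i - iθ`, which lie within
`(M - 1)θ < π - π/M` of one another, so the sum is at least a fixed positive multiple of the sum of
the norms (`cos_mul_sum_norm_le_norm_sum`). By continuity this persists for `θ = 0` and `θ = π/M`. A
zero of `f` would then be a common zero of all `p_i`, which is impossible. The origin is treated
separately, through `a_n`. -/

namespace GenHurwitz

/-! ### The Routh algorithm for a pair of polynomials -/

/-- The Hurwitz matrix of a pair of polynomials: the rows are the coefficient sequences of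
`Q, P, X * Q, X * P, X ^ 2 * Q, ...`. -/
noncomputable def pairMatrix (P Q : ℝ[X]) : Matrix ℕ ℕ ℝ :=
  Matrix.of fun r c => ((if r % 2 = 0 then Q else P) * X ^ (r / 2)).coeff c

theorem leadingMinor_one_pairMatrix (P Q : ℝ[X]) :
    leadingMinor (pairMatrix P Q) 1 = Q.coeff 0 := by
  simp [leadingMinor, pairMatrix]

/-- One step of the Routh algorithm, on the level of leading principal minors. -/
theorem leadingMinor_pairMatrix_succ {P Q R : ℝ[X]} {c : ℝ} (h : P = C c * Q + X * R) (r : ℕ) :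
    leadingMinor (pairMatrix P Q) (r + 1) = Q.coeff 0 * leadingMinor (pairMatrix Q R) r := by
  -- Subtracting `c` times the preceding row from each `P`-row leaves the rows `Q, X R, X Q, X^2 R,
  -- ...`. The first column is then zero below `Q.coeff 0`, and the complementary block has rows `R,
  -- Q, X R, X Q, ...`.
  let B : Matrix (Fin (r + 1)) (Fin (r + 1)) ℝ := Matrix.of fun k l =>
    ((if (k : ℕ) % 2 = 0 then Q * X ^ ((k : ℕ) / 2) else R * X ^ ((k : ℕ) / 2 + 1))).coeff l
  have hdet : leadingMinor (pairMatrix P Q) (r + 1) = B.det := by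
    refine Matrix.det_eq_of_forall_row_eq_smul_add_pred
      (fun k => if (k : ℕ) % 2 = 0 then c else 0) (fun l => ?_) (fun k l => ?_)
    · simp [B, pairMatrix]
    · rcases Nat.mod_two_eq_zero_or_one k with hk | hk
      · have h1 : ((k : ℕ) + 1) % 2 = 1 := by omega
        have h2 : ((k : ℕ) + 1) / 2 = (k : ℕ) / 2 := by omega
        simp only [B, pairMatrix, Matrix.of_apply, Fin.val_succ, Fin.val_castSucc, h1, h2, hk,
          one_ne_zero, if_false, if_true, ← coeff_C_mul, ← coeff_add]
        congr 1
        rw [h]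
        ring
      · have h1 : ((k : ℕ) + 1) % 2 = 0 := by omega
        simp [B, pairMatrix, h1, hk]
  rw [hdet, Matrix.det_succ_column_zero, Fin.sum_univ_succ, Finset.sum_eq_zero, add_zero]
  · have h0 : B 0 0 = Q.coeff 0 := by simp [B]
    rw [h0]
    simp only [Fin.val_zero, pow_zero, one_mul, leadingMinor]
    congr 2
    ext k l
    rcases Nat.mod_two_eq_zero_or_one k with hk | hk
    · have h1 : ((k : ℕ) + 1) % 2 = 1 := by omega
      have h2 : ((k : ℕ) + 1) / 2 = (k : ℕ) / 2 := by omega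
      simp [B, pairMatrix, hk, h1, h2, pow_succ, ← mul_assoc]
    · have h1 : ((k : ℕ) + 1) % 2 = 0 := by omega
      have h2 : ((k : ℕ) + 1) / 2 = (k : ℕ) / 2 + 1 := by omega
      simp [B, pairMatrix, hk, h1, h2, pow_succ, ← mul_assoc]
  · intro k _
    have : B k.succ 0 = 0 := by
      have h2 : ((k : ℕ) + 1) % 2 = 0 → ((k : ℕ) + 1) / 2 = (k : ℕ) / 2 + 1 := by omega
      simp only [B, Matrix.of_apply, Fin.val_succ, Fin.val_zero]
      split_ifs with hk
      · simp [h2 hk, pow_succ, ← mul_assoc]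
      · simp [pow_succ, ← mul_assoc]
    rw [this]
    ring

open ComplexConjugate in
/-- The pairs with positive leading principal minors have no common zero, and in the lower half
plane `P w / Q w` lies in the cone spanned by `1` and `w`. -/
theorem aeval_mem_cone_of_leadingMinor_pos (m : ℕ) : ∀ {P Q : ℝ[X]}, 0 < P.coeff 0 →
    (∀ k, m < 2 * k → P.coeff k = 0) → (∀ k, m ≤ 2 * k → Q.coeff k = 0) →
    (∀ r, 1 ≤ r → r ≤ m → 0 < leadingMinor (pairMatrix P Q) r) →
    (∀ w : ℂ, aeval w P = 0 → aeval w Q ≠ 0) ∧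
    ∀ w : ℂ, w.im < 0 → aeval w P ≠ 0 ∧ (0 < m → aeval w Q ≠ 0) ∧
      ∃ s t : ℝ, 0 ≤ s ∧ 0 ≤ t ∧ aeval w P * conj (aeval w Q) = s + t * w := by
  induction m with
  | zero =>
    intro P Q h0 hP hQ _
    have hP' : P = C (P.coeff 0) := by
      ext k
      rcases Nat.eq_zero_or_pos k with rfl | hk
      · simp
      · rw [hP k (by omega), coeff_C, if_neg hk.ne']
    have hQ' : Q = 0 := by
      ext k
      simpa using hQ k (by omega)
    have hw : ∀ w : ℂ, aeval w P ≠ 0 := by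
      intro w
      rw [hP', aeval_C]
      simpa using h0.ne'
    exact ⟨fun w h => absurd h (hw w), fun w _ => ⟨hw w, fun h => absurd h (lt_irrefl 0), 0, 0, le_rfl, le_rfl, by simp [hQ']⟩⟩
  | succ m ih =>
    intro P Q h0 hP hQ hmin
    have hq : 0 < Q.coeff 0 := by
      rw [← leadingMinor_one_pairMatrix P Q]
      exact hmin 1 le_rfl (by omega)
    obtain ⟨c, hc⟩ : ∃ c, c = P.coeff 0 / Q.coeff 0 := ⟨_, rfl⟩
    have hcpos : 0 < c := hc ▸ div_pos h0 hq
    obtain ⟨R, hR⟩ : ∃ R, R = divX (P - C c * Q) := ⟨_, rfl⟩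
    have hPR : P = C c * Q + X * R := by
      have h1 := X_mul_divX_add (P - C c * Q)
      have h2 : (P - C c * Q).coeff 0 = 0 := by
        rw [coeff_sub, coeff_C_mul, hc, div_mul_cancel₀ _ hq.ne', sub_self]
      rw [h2, C_0, add_zero, ← hR] at h1
      rw [h1]
      ring
    -- Dividing by `X` lowers the degree by one, so the bounds for `(P, Q)` at `m + 1` become those
    -- for `(Q, R)` at `m`.
    obtain ⟨ih1, ih2⟩ := ih (P := Q) (Q := R) hq (fun k hk => hQ k (by omega))
      (fun k hk => by
        rw [hR, coeff_divX, coeff_sub, coeff_C_mul, hP _ (by omega), hQ _ (by omega)]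
        simp)
      (fun r hr1 hr2 => by
        have := hmin (r + 1) (by omega) (by omega)
        rw [leadingMinor_pairMatrix_succ hPR] at this
        exact (pos_iff_pos_of_mul_pos this).1 hq)
    have hev : ∀ w : ℂ, aeval w P = c * aeval w Q + w * aeval w R := by
      intro w
      conv_lhs => rw [hPR]
      simp
    refine ⟨fun w hPw hQw => ?_, fun w hw => ?_⟩
    · rcases eq_or_ne w 0 with rfl | hw
      · have : (aeval (0 : ℂ) Q) = (Q.coeff 0 : ℂ) := by
          rw [aeval_def, eval₂_at_zero]; rfl
        rw [this] at hQw
        exact hq.ne' (by exact_mod_cast hQw)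
      · have h := hev w
        rw [hPw, hQw, mul_zero, zero_add, eq_comm] at h
        exact ih1 w hQw ((mul_eq_zero.1 h).resolve_left hw)
    · obtain ⟨hne, -, s, t, hs, ht, hst⟩ := ih2 w hw
      have hst' : aeval w R * conj (aeval w Q) = s + t * conj w := by
        have := congrArg conj hst
        simpa [mul_comm] using this
      -- Multiplying `R conj(Q) = s + t conj w` by `w` gives `s w + t |w|^2`, again in the cone of
      -- `1` and `w`; the term `c |Q|^2` makes the coefficient of `1` positive.
      have key : aeval w P * conj (aeval w Q) =
          ((c * Complex.normSq (aeval w Q) + t * Complex.normSq w : ℝ) : ℂ) + (s : ℂ) * w := by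
        rw [hev w]
        push_cast
        rw [← Complex.mul_conj, ← Complex.mul_conj]
        linear_combination w * hst'
      have hpos : 0 < c * Complex.normSq (aeval w Q) + t * Complex.normSq w :=
        add_pos_of_pos_of_nonneg (mul_pos hcpos (Complex.normSq_pos.2 hne))
          (mul_nonneg ht (Complex.normSq_nonneg _))
      refine ⟨fun hPw => ?_, fun _ => hne, _, s, hpos.le, hs, key⟩
      rw [hPw, zero_mul] at key
      have him := congrArg Complex.im key
      have hre := congrArg Complex.re key
      simp only [Complex.zero_im, Complex.zero_re, Complex.add_im, Complex.add_re,
        Complex.ofReal_im, Complex.ofReal_re, Complex.re_ofReal_mul, Complex.im_ofReal_mul,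
        zero_add] at him hre
      have hs0 : s = 0 := by
        rcases mul_eq_zero.1 him.symm with h | h
        · exact h
        · exact absurd h hw.ne
      rw [hs0, zero_mul, add_zero] at hre
      exact hpos.ne hre

/-! ### Splitting by residues modulo `M` -/

/-- The polynomial `∑ a_{M q + i} X ^ q`. -/
noncomputable def residuePart (f : ℝ[X]) (M i : ℕ) : ℝ[X] :=
  ∑ q ∈ Finset.range (f.natDegree + 1), monomial q (a f ((M : ℤ) * q + i))

theorem a_of_lt (f : ℝ[X]) {k : ℤ} (hk : (f.natDegree : ℤ) < k) : a f k = 0 :=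
  if_neg fun h => absurd h.2 (not_le.2 hk)

theorem a_of_neg (f : ℝ[X]) {k : ℤ} (hk : k < 0) : a f k = 0 :=
  if_neg fun h => absurd h.1 (not_le.2 hk)

theorem a_natCast (f : ℝ[X]) {k : ℕ} (hk : k ≤ f.natDegree) :
    a f k = f.coeff (f.natDegree - k) := by
  rw [a, if_pos ⟨by positivity, by exact_mod_cast hk⟩, Int.toNat_natCast]

theorem coeff_residuePart (f : ℝ[X]) {M : ℕ} (hM : 0 < M) (i q : ℕ) :
    (residuePart f M i).coeff q = a f ((M : ℤ) * q + i) := by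
  rw [residuePart, finsetSum_coeff]
  simp only [coeff_monomial]
  rw [Finset.sum_ite_eq' (Finset.range (f.natDegree + 1)) q
    (fun k : ℕ => a f ((M : ℤ) * k + i))]
  split_ifs with h
  · rfl
  · rw [a_of_lt]
    rw [Finset.mem_range, not_lt] at h
    have : (1 : ℤ) * q ≤ M * q := by gcongr; exact_mod_cast hM
    omega

theorem hurwitzSub_eq_pairMatrix (f : ℝ[X]) {M i j : ℕ} (hi : i < M) (hj : j < M) :
    hurwitzSub f M i j = pairMatrix (residuePart f M i) (residuePart f M j) := by
  have hM : 0 < M := by omega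
  have aux : ∀ l < M, ∀ q c : ℕ, (residuePart f M l * X ^ q).coeff c =
      a f ((M : ℤ) * ((c : ℤ) - (q : ℤ)) + (l : ℤ)) := by
    intro l hl q c
    rw [coeff_mul_X_pow']
    split_ifs with h
    · rw [coeff_residuePart f hM, Nat.cast_sub h]
    · rw [a_of_neg]
      have : (M : ℤ) * (c - q) ≤ M * (-1) := by gcongr; omega
      omega
  ext r c
  rcases Nat.even_or_odd' r with ⟨q, rfl | rfl⟩
  · have h1 : 2 * q / 2 = q := by omega
    rw [hurwitzSub_even f hj, ← aux j hj]
    simp [pairMatrix]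
  · have h1 : (2 * q + 1) / 2 = q := by omega
    have h2 : (2 * q + 1) % 2 = 1 := by omega
    rw [hurwitzSub_odd f hi, ← aux i hi]
    simp [pairMatrix, h1, h2]

theorem sum_range_mul_eq {E : Type*} [AddCommMonoid E] (g : ℕ → E) (M N : ℕ) :
    ∑ k ∈ Finset.range (M * N), g k =
      ∑ i ∈ Finset.range M, ∑ q ∈ Finset.range N, g (M * q + i) := by
  rw [Finset.sum_comm]
  induction N with
  | zero => simp
  | succ N ih => rw [mul_add, mul_one, Finset.sum_range_add, ih, Finset.sum_range_succ]

theorem aeval_eq_sum_residuePart (f : ℝ[X]) {M : ℕ} (hM : 0 < M) {z : ℂ} (hz : z ≠ 0) :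
    aeval z f = z ^ f.natDegree *
      ∑ i ∈ Finset.range M, z⁻¹ ^ i * aeval (z⁻¹ ^ M) (residuePart f M i) := by
  have h1 : ∑ i ∈ Finset.range M, z⁻¹ ^ i * aeval (z⁻¹ ^ M) (residuePart f M i) =
      ∑ k ∈ Finset.range (M * (f.natDegree + 1)), (a f k : ℂ) * z⁻¹ ^ k := by
    rw [sum_range_mul_eq]
    refine Finset.sum_congr rfl fun i _ => ?_
    rw [residuePart, map_sum, Finset.mul_sum]
    refine Finset.sum_congr rfl fun q _ => ?_
    rw [aeval_monomial]
    push_cast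
    rw [Complex.coe_algebraMap, pow_add, pow_mul]
    ring
  have h2 : ∑ k ∈ Finset.range (M * (f.natDegree + 1)), (a f k : ℂ) * z⁻¹ ^ k =
      ∑ k ∈ Finset.range (f.natDegree + 1), (a f k : ℂ) * z⁻¹ ^ k := by
    symm
    refine Finset.sum_subset (fun k hk => ?_) (fun k _ hk => ?_)
    · rw [Finset.mem_range] at hk ⊢
      nlinarith
    · rw [Finset.mem_range, not_lt] at hk
      rw [a_of_lt f (by exact_mod_cast hk)]
      simp
  rw [h1, h2, aeval_eq_sum_range, Finset.mul_sum,
    ← Finset.sum_range_reflect _ (f.natDegree + 1)]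
  refine Finset.sum_congr rfl fun k hk => ?_
  have hk' : k ≤ f.natDegree := by
    rw [Finset.mem_range] at hk
    omega
  rw [a_natCast f hk', show f.natDegree + 1 - 1 - k = f.natDegree - k by omega,
    pow_sub₀ z hz hk', Algebra.smul_def, Complex.coe_algebraMap, inv_pow]
  ring

/-! ### Arguments of complex numbers -/

/-- Complex numbers whose arguments lie within `β ≤ π` of one another do not cancel. -/
theorem cos_mul_sum_norm_le_norm_sum {ι : Type*} (s : Finset ι) (T : ι → ℂ) (ψ : ι → ℝ) {β : ℝ}
    (hβ : β ≤ Real.pi) (hT : ∀ i ∈ s, T i = ‖T i‖ * Complex.exp (ψ i * Complex.I))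
    (hψ : ∀ i ∈ s, ∀ j ∈ s, ψ i - ψ j ≤ β) :
    Real.cos (β / 2) * ∑ i ∈ s, ‖T i‖ ≤ ‖∑ i ∈ s, T i‖ := by
  rcases s.eq_empty_or_nonempty with rfl | hs
  · simp
  obtain ⟨i₁, hi₁, h₁⟩ := s.exists_max_image ψ hs
  obtain ⟨i₀, hi₀, h₀⟩ := s.exists_min_image ψ hs
  -- After rotation by the middle angle every argument is within `β / 2` of `0`, so the real parts
  -- alone give the bound.
  obtain ⟨μ, hμ⟩ : ∃ μ, μ = (ψ i₁ + ψ i₀) / 2 := ⟨_, rfl⟩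
  have hb := hψ i₁ hi₁ i₀ hi₀
  have hu : ‖Complex.exp ((-μ : ℝ) * Complex.I)‖ = 1 := Complex.norm_exp_ofReal_mul_I _
  rw [← mul_one ‖∑ i ∈ s, T i‖, ← hu, ← norm_mul]
  refine le_trans ?_ (Complex.re_le_norm _)
  rw [Finset.sum_mul, Complex.re_sum, Finset.mul_sum]
  refine Finset.sum_le_sum fun i hi => ?_
  have : T i * Complex.exp ((-μ : ℝ) * Complex.I) =
      (‖T i‖ : ℝ) * Complex.exp ((ψ i - μ : ℝ) * Complex.I) := by
    conv_lhs => rw [hT i hi]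
    rw [mul_assoc, ← Complex.exp_add]
    congr 2
    push_cast
    ring
  rw [this, Complex.re_ofReal_mul, Complex.exp_ofReal_mul_I_re, mul_comm]
  gcongr
  rw [← Real.cos_abs (ψ i - μ)]
  have h2 := h₁ i hi
  have h3 := h₀ i hi
  apply Real.cos_le_cos_of_nonneg_of_le_pi (abs_nonneg _) (by linarith)
  rw [abs_le]
  constructor <;> linarith

open ComplexConjugate in
theorem im_mul_conj_eq (u v : ℂ) :
    (u * conj v).im = ‖u‖ * ‖v‖ * Real.sin (u.arg - v.arg) := by
  rw [Real.sin_sub, Complex.mul_im, Complex.conj_re, Complex.conj_im,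
    ← Complex.norm_mul_cos_arg u, ← Complex.norm_mul_cos_arg v, ← Complex.norm_mul_sin_arg u,
    ← Complex.norm_mul_sin_arg v]
  ring

open ComplexConjugate in
theorem arg_le_arg_of_im_mul_conj_nonneg {u v : ℂ} (hu : u ≠ 0) (hv : v ≠ 0)
    (h : v.arg - u.arg < Real.pi) (him : 0 ≤ (u * conj v).im) : v.arg ≤ u.arg := by
  by_contra! hlt
  rw [im_mul_conj_eq] at him
  have h1 : Real.sin (u.arg - v.arg) < 0 :=
    Real.sin_neg_of_neg_of_neg_pi_lt (by linarith) (by linarith)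
  have h2 : 0 < ‖u‖ * ‖v‖ := by positivity
  nlinarith

open ComplexConjugate in
/-- Complex numbers whose successive quotients lie in the cone spanned by `1` and `v` have
increasing arguments, in an interval of length `arg v`. -/
theorem exists_monotone_args {M : ℕ} {p : ℕ → ℂ} {v : ℂ} (hv : 0 < v.im)
    (hp : ∀ i < M, p i ≠ 0)
    (hcone : ∀ i j, i < j → j < M → ∃ s t : ℝ, 0 ≤ s ∧ 0 ≤ t ∧ p j * conj (p i) = s + t * v) :
    ∃ φ : ℕ → ℝ, (∀ i < M, p i = ‖p i‖ * Complex.exp (φ i * Complex.I)) ∧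
      ∀ i j, i < j → j < M → φ i ≤ φ j ∧ φ j ≤ φ i + v.arg := by
  rcases Nat.eq_zero_or_pos M with rfl | hM
  · exact ⟨0, by simp, by simp⟩
  have h0 := hp 0 hM
  have hv0 : v ≠ 0 := by
    rintro rfl
    simp at hv
  have hvarg : 0 ≤ v.arg := Complex.arg_nonneg_iff.2 hv.le
  have hvpi : v.arg < Real.pi := Complex.arg_lt_pi_iff.2 (Or.inr hv.ne')
  have hu : ∀ i < M, p i * conj (p 0) ≠ 0 := fun i hi =>
    mul_ne_zero (hp i hi) ((_root_.map_ne_zero _).2 h0)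
  -- Relative to `p 0`, all principal arguments lie in `[0, arg v]` with `arg v < π`, so they can be
  -- compared without crossing the branch cut.
  have hbound : ∀ i < M, 0 ≤ (p i * conj (p 0)).arg ∧ (p i * conj (p 0)).arg ≤ v.arg := by
    intro i hi
    rcases Nat.eq_zero_or_pos i with rfl | hi0
    · rw [Complex.mul_conj, Complex.arg_ofReal_of_nonneg (Complex.normSq_nonneg _)]
      exact ⟨le_rfl, hvarg⟩
    · obtain ⟨s, t, hs, ht, h⟩ := hcone 0 i hi0 hi
      have hui := hu i hi
      rw [h] at hui ⊢
      have h1 : 0 ≤ (s + t * v : ℂ).arg := by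
        rw [Complex.arg_nonneg_iff]
        simpa using mul_nonneg ht hv.le
      refine ⟨h1, arg_le_arg_of_im_mul_conj_nonneg hv0 hui ?_ ?_⟩
      · linarith [Complex.arg_le_pi (s + t * v : ℂ), (Complex.arg_le_pi (s + t * v : ℂ)).lt_of_ne
          (fun h2 => by
            obtain ⟨h3, h4⟩ := Complex.arg_eq_pi_iff.1 h2
            have h5 : t * v.im = 0 := by simpa using h4
            have h6 : t = 0 := (mul_eq_zero.1 h5).resolve_right hv.ne'
            rw [h6] at h3
            have : s < 0 := by simpa using h3
            linarith)]
      · have : (v * conj (s + t * v : ℂ)).im = s * v.im := by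
          simp
          ring
        rw [this]
        exact mul_nonneg hs hv.le
  refine ⟨fun i => (p i * conj (p 0)).arg + (p 0).arg, fun i hi => ?_, fun i j hij hj => ⟨?_, ?_⟩⟩
  · have h1 := Complex.norm_mul_exp_arg_mul_I (p i * conj (p 0))
    have h2 := Complex.norm_mul_exp_arg_mul_I (p 0)
    have h3 : p 0 * conj (p 0) = (‖p 0‖ : ℂ) * ‖p 0‖ := by
      rw [Complex.mul_conj, Complex.normSq_eq_norm_sq]
      push_cast
      ring
    have h4 : (‖p 0‖ : ℂ) ≠ 0 := by simpa using h0
    rw [norm_mul, Complex.norm_conj] at h1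
    push_cast at h1 ⊢
    rw [add_mul, Complex.exp_add]
    apply mul_right_cancel₀ (mul_ne_zero h4 h4)
    rw [← h3]
    linear_combination (-p 0) * h1 - Complex.exp ((p i * conj (p 0)).arg * Complex.I) *
      ‖p i‖ * ‖p 0‖ * h2 + Complex.exp ((p i * conj (p 0)).arg * Complex.I) *
      ‖p i‖ * Complex.exp ((p 0).arg * Complex.I) * (-h3)
  · have hi := hij.trans hj
    obtain ⟨s, t, hs, ht, h⟩ := hcone i j hij hj
    refine add_le_add_left (arg_le_arg_of_im_mul_conj_nonneg (hu j hj) (hu i hi) ?_ ?_) _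
    · linarith [(hbound j hj).1, (hbound i hi).2]
    · have : p j * conj (p 0) * conj (p i * conj (p 0)) =
          (Complex.normSq (p 0) : ℂ) * (s + t * v) := by
        rw [← h, ← Complex.mul_conj, map_mul, Complex.conj_conj]
        ring
      rw [this, Complex.im_ofReal_mul]
      refine mul_nonneg (Complex.normSq_nonneg _) ?_
      simpa using mul_nonneg ht hv.le
  · linarith [(hbound j hj).2, (hbound i (hij.trans hj)).1]

/-! ### The cone property of the residue parts -/

/-- All the pairs of residues have positive leading principal minors. -/
def MinorsPos (f : ℝ[X]) (M : ℕ) : Prop :=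
  ∀ i j : ℕ, i < j → j < M → ∀ r : ℕ, 1 ≤ r → r ≤ pairDegree f.natDegree M i j →
    0 < leadingMinor (hurwitzSub f M i j) r

theorem coeff_residuePart_eq_zero (f : ℝ[X]) {M i q : ℕ} (hM : 0 < M)
    (hi : i ≤ f.natDegree) (hq : (f.natDegree - i) / M < q) : (residuePart f M i).coeff q = 0 := by
  rw [coeff_residuePart f hM]
  apply a_of_lt
  rw [Nat.div_lt_iff_lt_mul hM, mul_comm] at hq
  have : f.natDegree < M * q + i := by omega
  exact_mod_cast this

theorem sub_div_le_sub_div_add_one {n M i j : ℕ} (hM : 0 < M) (hj : j < M) :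
    (n - i) / M ≤ (n - j) / M + 1 := by
  rw [← Nat.add_div_right _ hM]
  exact Nat.div_le_div_right (by omega)

theorem one_le_pairDegree {n M i j : ℕ} (hij : i < j) :
    1 ≤ pairDegree n M i j := by
  have h2 : (n - j) / M ≤ (n - i) / M := Nat.div_le_div_right (by omega)
  unfold pairDegree
  generalize (n - i) / M = d at *
  generalize (n - j) / M = e at *
  split_ifs <;> omega

theorem coeff_zero_residuePart_pos {f : ℝ[X]} {M : ℕ} (hlead : 0 < f.leadingCoeff)
    (h : MinorsPos f M) {i : ℕ} (hi : i < M) : 0 < (residuePart f M i).coeff 0 := by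
  have hM : 0 < M := by omega
  rcases Nat.eq_zero_or_pos i with rfl | hi0
  · rw [coeff_residuePart f hM]
    have := a_natCast f (Nat.zero_le f.natDegree)
    simpa using this.symm ▸ hlead
  · have h1 := h 0 i hi0 hi 1 le_rfl (one_le_pairDegree hi0)
    rwa [hurwitzSub_eq_pairMatrix f hM hi, leadingMinor_one_pairMatrix] at h1

open ComplexConjugate in
theorem residuePart_cone {f : ℝ[X]} {M : ℕ} (hlead : 0 < f.leadingCoeff)
    (hMn : M ≤ f.natDegree + 1) (h : MinorsPos f M) {i j : ℕ} (hij : i < j) (hj : j < M) :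
    (∀ w : ℂ, aeval w (residuePart f M i) = 0 → aeval w (residuePart f M j) ≠ 0) ∧
    ∀ w : ℂ, w.im < 0 → aeval w (residuePart f M i) ≠ 0 ∧
      aeval w (residuePart f M j) ≠ 0 ∧ ∃ s t : ℝ, 0 ≤ s ∧ 0 ≤ t ∧
      aeval w (residuePart f M i) * conj (aeval w (residuePart f M j)) = s + t * w := by
  have hi := hij.trans hj
  have hM : 0 < M := by omega
  -- The degree bounds `d` for residue `i` and `e` for residue `j` satisfy `e ≤ d ≤ e + 1`. The two
  -- cases `m = 2d + 1` and `m = 2d` of `pairDegree` both yield the vanishing required by the Routh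
  -- induction.
  have h1 := sub_div_le_sub_div_add_one (n := f.natDegree) (i := i) hM hj
  have h2 : (f.natDegree - j) / M ≤ (f.natDegree - i) / M := Nat.div_le_div_right (by omega)
  have h3 := one_le_pairDegree (n := f.natDegree) (M := M) hij
  refine And.imp id (fun H w hw => ⟨(H w hw).1, (H w hw).2.1 h3, (H w hw).2.2⟩)
    (aeval_mem_cone_of_leadingMinor_pos (pairDegree f.natDegree M i j)
    (coeff_zero_residuePart_pos hlead h hi) (fun k hk => ?_) (fun k hk => ?_) (fun r hr1 hr2 => ?_))
  · apply coeff_residuePart_eq_zero f hM (by omega)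
    unfold pairDegree at hk
    split_ifs at hk <;> omega
  · apply coeff_residuePart_eq_zero f hM (by omega)
    unfold pairDegree at hk
    split_ifs at hk <;> omega
  · rw [← hurwitzSub_eq_pairMatrix f hi hj]
    exact h i j hij hj r hr1 hr2

theorem residuePart_ne_zero {f : ℝ[X]} {M : ℕ} (hlead : 0 < f.leadingCoeff) (hM : 2 ≤ M)
    (hMn : M ≤ f.natDegree + 1) (h : MinorsPos f M) {i : ℕ} (hi : i < M) {w : ℂ} (hw : w.im < 0) :
    aeval w (residuePart f M i) ≠ 0 := by
  rcases Nat.lt_or_ge (i + 1) M with hi1 | hi1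
  · exact ((residuePart_cone hlead hMn h (Nat.lt_succ_self i) hi1).2 w hw).1
  · exact ((residuePart_cone hlead hMn h (show 0 < i by omega) hi).2 w hw).2.1

/-! ### No zeros in the closed cone away from the origin -/

/-- The terms of `x ^ (-n) * f x` belonging to the residues modulo `M`. -/
noncomputable def residueTerm (f : ℝ[X]) (M : ℕ) (x : ℂ) (i : ℕ) : ℂ :=
  x⁻¹ ^ i * aeval (x⁻¹ ^ M) (residuePart f M i)

-- The constant does not depend on `θ`, so the estimate survives the limit to the boundary rays;
-- there `w` is real and single residue parts may vanish.
open ComplexConjugate in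
theorem cos_mul_sum_norm_residueTerm_le {f : ℝ[X]} {M : ℕ} (hlead : 0 < f.leadingCoeff)
    (hM : 2 ≤ M) (hMn : M ≤ f.natDegree + 1) (h : MinorsPos f M) {ρ θ : ℝ} (hρ : 0 < ρ)
    (hθ0 : 0 < θ) (hθ : θ < Real.pi / M) :
    Real.cos ((Real.pi - Real.pi / M) / 2) *
        ∑ i ∈ Finset.range M, ‖residueTerm f M (ρ * Complex.exp (θ * Complex.I)) i‖ ≤
      ‖∑ i ∈ Finset.range M, residueTerm f M (ρ * Complex.exp (θ * Complex.I)) i‖ := by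
  have hM0 : (0 : ℝ) < M := by
    have : 0 < M := by omega
    exact_mod_cast this
  have hMθ : M * θ < Real.pi := by
    rw [lt_div_iff₀ hM0] at hθ
    linarith
  obtain ⟨w, hw⟩ : ∃ w, w = (ρ * Complex.exp (θ * Complex.I))⁻¹ ^ M := ⟨_, rfl⟩
  have hconj : conj w = ((ρ⁻¹ ^ M : ℝ) : ℂ) *
      (Complex.cos ((M * θ : ℝ)) + Complex.sin ((M * θ : ℝ)) * Complex.I) := by
    rw [← Complex.exp_mul_I, hw, map_pow, map_inv₀, map_mul, ← Complex.exp_conj]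
    simp only [map_mul, Complex.conj_ofReal, Complex.conj_I, mul_inv, ← Complex.exp_neg, mul_pow,
      ← Complex.exp_nat_mul]
    push_cast
    congr 2
    ring
  have harg : (conj w).arg = M * θ := by
    rw [hconj]
    exact Complex.arg_mul_cos_add_sin_mul_I (by positivity)
      ⟨by linarith [Real.pi_pos, mul_pos hM0 hθ0], hMθ.le⟩
  have hvim : 0 < (conj w).im := by
    rw [hconj, Complex.im_ofReal_mul, ← Complex.exp_mul_I, Complex.exp_ofReal_mul_I_im]
    exact mul_pos (by positivity) (Real.sin_pos_of_pos_of_lt_pi (by positivity) hMθ)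
  have hwim : w.im < 0 := by
    rw [Complex.conj_im] at hvim
    linarith
  obtain ⟨φ, hφ1, hφ2⟩ := exists_monotone_args (M := M)
    (p := fun i => aeval w (residuePart f M i)) hvim
    (fun i hi => residuePart_ne_zero hlead hM hMn h hi hwim)
    (fun i j hij hj => by
      obtain ⟨-, -, s, t, hs, ht, hst⟩ := (residuePart_cone hlead hMn h hij hj).2 w hwim
      refine ⟨s, t, hs, ht, ?_⟩
      have := congrArg conj hst
      simpa [mul_comm] using this)
  rw [harg] at hφ2
  have hβ : Real.pi - Real.pi / M = (M - 1) * (Real.pi / M) := by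
    field_simp
  refine cos_mul_sum_norm_le_norm_sum _ _ (fun i => φ i - i * θ)
    (by linarith [div_pos Real.pi_pos hM0]) (fun i hi => ?_) (fun i hi j hj => ?_)
  · rw [Finset.mem_range] at hi
    have h1 : (ρ * Complex.exp (θ * Complex.I))⁻¹ ^ i =
        ‖(ρ * Complex.exp (θ * Complex.I))⁻¹ ^ i‖ * Complex.exp (-(i * θ) * Complex.I) := by
      rw [norm_pow, norm_inv, norm_mul, Complex.norm_exp_ofReal_mul_I, Complex.norm_real,
        Real.norm_of_nonneg hρ.le, mul_inv, ← Complex.exp_neg, mul_pow, ← Complex.exp_nat_mul]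
      push_cast
      rw [mul_one]
      congr 2
      ring
    rw [residueTerm, ← hw, norm_mul]
    conv_lhs => rw [h1, hφ1 i hi]
    push_cast
    rw [sub_eq_add_neg, add_mul (φ i : ℂ), Complex.exp_add]
    ring
  · rw [Finset.mem_range] at hi hj
    have h1 : (M - 1) * θ ≤ (M - 1) * (Real.pi / M) := by
      have : (2 : ℝ) ≤ M := by exact_mod_cast hM
      gcongr
      linarith
    rw [hβ]
    refine le_trans ?_ h1
    -- For `i < j` monotonicity of `φ` leaves at most `(j - i)θ`; for `i > j` the spread gives at
    -- most `Mθ - (i - j)θ`. Both are at most `(M - 1)θ`.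
    rcases lt_trichotomy i j with hij | rfl | hij
    · have h2 := (hφ2 i j hij hj).1
      have h3 : (j : ℝ) + 1 ≤ M := by exact_mod_cast hj
      nlinarith [mul_nonneg (Nat.cast_nonneg (α := ℝ) i) hθ0.le]
    · have h3 : (i : ℝ) + 1 ≤ M := by exact_mod_cast hj
      nlinarith [mul_nonneg (Nat.cast_nonneg (α := ℝ) i) hθ0.le]
    · have h2 := (hφ2 j i hij hi).2
      have h3 : (j : ℝ) + 1 ≤ i := by exact_mod_cast hij
      nlinarith

theorem aeval_ne_zero_of_minorsPos {f : ℝ[X]} {M : ℕ} (hlead : 0 < f.leadingCoeff)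
    (hM : 2 ≤ M) (hMn : M ≤ f.natDegree + 1) (h : MinorsPos f M) {z : ℂ} (hz : z ≠ 0)
    (h0 : 0 ≤ z.arg) (h1 : z.arg ≤ Real.pi / M) : aeval z f ≠ 0 := by
  have hM0 : (0 : ℝ) < M := by
    have : 0 < M := by omega
    exact_mod_cast this
  have hpiM : 0 < Real.pi / M := div_pos Real.pi_pos hM0
  have hnz : ∀ θ : ℝ, (‖z‖ : ℂ) * Complex.exp (θ * Complex.I) ≠ 0 := fun θ =>
    mul_ne_zero (by simpa using hz) (Complex.exp_ne_zero _)
  have hcont : ∀ i, Continuous fun θ : ℝ =>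
      residueTerm f M ((‖z‖ : ℂ) * Complex.exp (θ * Complex.I)) i := by
    intro i
    have hx : Continuous fun θ : ℝ => ((‖z‖ : ℂ) * Complex.exp (θ * Complex.I))⁻¹ :=
      Continuous.inv₀ (by fun_prop) hnz
    exact (hx.pow i).mul ((Polynomial.continuous_aeval _).comp (hx.pow M))
  have hclosed : IsClosed {θ : ℝ | Real.cos ((Real.pi - Real.pi / M) / 2) *
        ∑ i ∈ Finset.range M, ‖residueTerm f M (‖z‖ * Complex.exp (θ * Complex.I)) i‖ ≤
      ‖∑ i ∈ Finset.range M, residueTerm f M (‖z‖ * Complex.exp (θ * Complex.I)) i‖} :=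
    isClosed_le (continuous_const.mul (continuous_finsetSum _ fun i _ => (hcont i).norm))
      (continuous_finsetSum _ fun i _ => hcont i).norm
  have hsub : Set.Icc 0 (Real.pi / M) ⊆ {θ : ℝ | Real.cos ((Real.pi - Real.pi / M) / 2) *
        ∑ i ∈ Finset.range M, ‖residueTerm f M (‖z‖ * Complex.exp (θ * Complex.I)) i‖ ≤
      ‖∑ i ∈ Finset.range M, residueTerm f M (‖z‖ * Complex.exp (θ * Complex.I)) i‖} := by
    rw [← closure_Ioo hpiM.ne]
    exact hclosed.closure_subset_iff.2 fun θ hθ =>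
      cos_mul_sum_norm_residueTerm_le hlead hM hMn h (norm_pos_iff.2 hz) hθ.1 hθ.2
  have hmain := hsub ⟨h0, h1⟩
  simp only [Set.mem_ofPred_eq, Complex.norm_mul_exp_arg_mul_I] at hmain
  have hcos : 0 < Real.cos ((Real.pi - Real.pi / M) / 2) := by
    have : Real.pi / M ≤ Real.pi := div_le_self Real.pi_pos.le (by
      have : 1 ≤ M := by omega
      exact_mod_cast this)
    apply Real.cos_pos_of_mem_Ioo
    constructor <;> linarith
  intro hf
  rw [aeval_eq_sum_residuePart f (by omega : 0 < M) hz] at hf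
  have hsum := (mul_eq_zero.1 hf).resolve_left (pow_ne_zero _ hz)
  simp only [residueTerm] at hmain
  rw [hsum, norm_zero] at hmain
  have hle : ∑ i ∈ Finset.range M, ‖z⁻¹ ^ i * aeval (z⁻¹ ^ M) (residuePart f M i)‖ ≤ 0 := by
    by_contra! hpos
    exact absurd hmain (not_le.2 (mul_pos hcos hpos))
  have hzero := (Finset.sum_eq_zero_iff_of_nonneg fun i _ => norm_nonneg _).1
    (le_antisymm hle (Finset.sum_nonneg fun i _ => norm_nonneg _))
  have hP : ∀ i < M, aeval (z⁻¹ ^ M) (residuePart f M i) = 0 := fun i hi =>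
    (mul_eq_zero.1 (norm_eq_zero.1 (hzero i (Finset.mem_range.2 hi)))).resolve_left
      (pow_ne_zero _ (inv_ne_zero hz))
  exact (residuePart_cone hlead hMn h zero_lt_one (by omega : 1 < M)).1 _
    (hP 0 (by omega)) (hP 1 (by omega))

/-! ### The origin and the conclusion -/

/-- The constant coefficient of `f` does not vanish, as it is the only nonzero entry in the last
column of one of the largest minors. -/
theorem coeff_zero_ne_zero_of_minorsPos {f : ℝ[X]} {M : ℕ} (hM : 2 ≤ M)
    (hMn : M ≤ f.natDegree + 1) (h : MinorsPos f M) : f.coeff 0 ≠ 0 := by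
  intro hf
  have hM0 : 0 < M := by omega
  have ha : ∀ k : ℤ, (f.natDegree : ℤ) ≤ k → a f k = 0 := by
    intro k hk
    rcases hk.lt_or_eq with hk | rfl
    · exact a_of_lt f hk
    · rw [a_natCast f le_rfl, Nat.sub_self, hf]
  have hcol : ∀ {i j m : ℕ}, i < j → j < M → pairDegree f.natDegree M i j = m + 1 →
      (∀ q c : ℕ, 2 * q ≤ m → m = c → (f.natDegree : ℤ) ≤ (M : ℤ) * (c - q) + j) →
      (∀ q c : ℕ, 2 * q + 1 ≤ m → m = c → (f.natDegree : ℤ) ≤ (M : ℤ) * (c - q) + i) → False := by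
    intro i j m hij hj hm h1 h2
    refine (h i j hij hj (m + 1) (by omega) hm.ge).ne' ?_
    apply Matrix.det_eq_zero_of_column_eq_zero (Fin.last m)
    rintro ⟨r, hr⟩
    simp only [Matrix.of_apply, Fin.val_last]
    rcases Nat.even_or_odd' r with ⟨q, rfl | rfl⟩
    · rw [hurwitzSub_even f hj]
      exact ha _ (h1 q m (by omega) rfl)
    · rw [hurwitzSub_odd f (hij.trans hj)]
      exact ha _ (h2 q m (by omega) rfl)
  -- With `n = M d + k`, the largest minor whose last diagonal entry is `a_n` comes from the pair
  -- `(0, 1)`, of order `2d`, if `k = 0`, and from `(0, k)`, of order `2d + 1`, otherwise. The other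
  -- entries of its last column have index above `n`.
  have hdm := Nat.div_add_mod f.natDegree M
  obtain ⟨d, hd⟩ : ∃ d, d = f.natDegree / M := ⟨_, rfl⟩
  obtain ⟨k, hk⟩ : ∃ k, k = f.natDegree % M := ⟨_, rfl⟩
  have hkM : k < M := hk ▸ Nat.mod_lt _ hM0
  rw [← hd, ← hk] at hdm
  have hdm' : (f.natDegree : ℤ) = M * d + k := by exact_mod_cast hdm.symm
  rcases Nat.eq_zero_or_pos k with hk0 | hk0
  · have hd0 : 0 < d := by
      rcases Nat.eq_zero_or_pos d with rfl | h'
      · omega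
      · exact h'
    obtain ⟨e, rfl⟩ : ∃ e, d = e + 1 := ⟨d - 1, by omega⟩
    have h1 : (f.natDegree - 1) / M = e := by
      rw [Nat.div_eq_iff hM0]
      have : M * (e + 1) = e * M + M := by ring
      omega
    refine hcol (i := 0) (j := 1) (m := 2 * e + 1) zero_lt_one (by omega) ?_ ?_ ?_
    · rw [pairDegree, h1, Nat.sub_zero, ← hd, if_neg (by omega)]
      ring
    · intro q c hq hc
      have : (M : ℤ) * ((e + 1 : ℕ) : ℤ) ≤ M * (c - q) := by gcongr; omega
      omega
    · intro q c hq hc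
      have : (M : ℤ) * ((e + 1 : ℕ) : ℤ) ≤ M * (c - q) := by gcongr; omega
      omega
  · have h1 : (f.natDegree - k) / M = d := by
      rw [← hdm, Nat.add_sub_cancel, Nat.mul_div_cancel_left _ hM0]
    refine hcol (i := 0) (j := k) (m := 2 * d) hk0 hkM ?_ ?_ ?_
    · rw [pairDegree, h1, Nat.sub_zero, ← hd, if_pos rfl]
    · intro q c hq hc
      have : (M : ℤ) * (d : ℤ) ≤ M * (c - q) := by gcongr; omega
      omega
    · intro q c hq hc
      have : (M : ℤ) * ((d : ℤ) + 1) ≤ M * (c - q) := by gcongr; omega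
      rw [mul_add, mul_one] at this
      omega

end GenHurwitz

open ComplexConjugate in
theorem mainTheorem6 (n M : ℕ) (f : ℝ[X]) (hdeg : f.natDegree = n) (hlead : 0 < f.coeff n)
    (hM2 : 2 ≤ M) (hMn : M ≤ n / 2 + 1)
    (hminors : ∀ i j : ℕ, i < j → j < M → ∀ r : ℕ, 1 ≤ r → r ≤ GenHurwitz.pairDegree n M i j →
      0 < GenHurwitz.leadingMinor (GenHurwitz.hurwitzSub f M i j) r) :
    ∀ z : ℂ, |Complex.arg z| ≤ Real.pi / (M : ℝ) → Polynomial.aeval z f ≠ 0 := by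
  subst hdeg
  have hMn' : M ≤ f.natDegree + 1 := by omega
  intro z hz
  rcases eq_or_ne z 0 with rfl | hz0
  · rw [Polynomial.aeval_def, Polynomial.eval₂_at_zero]
    simpa using GenHurwitz.coeff_zero_ne_zero_of_minorsPos hM2 hMn' hminors
  rcases le_or_gt 0 z.arg with h | h
  · rw [abs_of_nonneg h] at hz
    exact GenHurwitz.aeval_ne_zero_of_minorsPos hlead hM2 hMn' hminors hz0 h hz
  -- Real coefficients give `f(conj z) = conj(f(z))`, which reduces the lower half of the cone to
  -- the upper.
  · rw [abs_of_neg h] at hz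
    have harg : (conj z).arg = -z.arg := by
      rw [Complex.arg_conj, if_neg (by linarith [Real.pi_pos])]
    have := GenHurwitz.aeval_ne_zero_of_minorsPos hlead hM2 hMn' hminors (z := conj z)
      ((_root_.map_ne_zero _).2 hz0) (by rw [harg]; linarith) (by rw [harg]; exact hz)
    rw [Polynomial.aeval_conj] at this
    exact (_root_.map_ne_zero _).1 this
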